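/- Let $R$ be a commutative noetherian ring and let $H$ be a Hopf $R$-algebra with bijective antipode that is an $\alpha$-algebra; that is, the finite dual $H^{\circ}=\{f\in H^{*} : HfH \text{ is a finitely generated } R\text{-module}\}$ is a pure submodule of the module $R^{H}$ of all functions $H\to R$ (the map $H^\circ\otimes_R N\to R^H\otimes_R N$ is injective for every $R$-module $N$). Then $H^{\circ}$ is a bialgebra with the convolution product, counit $f\mapsto f(1)$ and comultiplication determined by $\sum f_1(a)f_2(b)=f(ab)$. For a right $H$-module coalgebra $E$ (so $\Delta(eh)=\sum e_1h_1\otimes e_2h_2$ and $\varepsilon(eh)=\varepsilon(e)\varepsilon(h)$), let $H$ act on $E^{*}$ by $(hf)(e)=f(eh)$, and let $E^{0}\subseteq E^{*}$ be the subalgebra (for convolution) of $H^\circ$-rational elements: those $f$ for which there is $\sum_i g_i\otimes c_i\in E^{*}\otimes_R H^{\circ}$ with $hf=\sum_i c_i(h)g_i$ for all $h\in H$. Then $E^{0}$ is a right $H^{\circ}$-comodule algebra, with coaction $\varrho(f)=\sum f_{0}\otimes f_{1}\in E^0\otimes_R H^\circ$ determined by $hf=\sum f_{1}(h)f_{0}$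 for all $h\in H$. Let $D$ be a right $H$-module coalgebra, $H^{+}=\ker\varepsilon_H$, $C=D/DH^{+}$ the quotient right $H$-module coalgebra, and $\pi:D\to C$ the canonical projection (a right $H$-coextension). Then: 1. $\pi^{\circ}:C^{0}\to D^{0}$, $g\mapsto g\circ\pi$, is a right $H^{\circ}$-extension: it is an injective algebra morphism whose image is the subalgebra of coinvariants $(D^{0})^{\mathrm{co}H^{\circ}}=\{f\in D^0 : \varrho(f)=f\otimes 1\}$. 2. If $\pi$ is cocleft, i.e. there is a right $H$-linear map $\omega:D\to H$ (a cointegral) that is invertible in the convolution algebra $\mathrm{Hom}_R(D,H)$, then $\pi^{\circ}$ is cleft, i.e. there is a right $H^{\circ}$-colinear map $H^{\circ}\to D^{0}$ (an integral) that is invertible in the convolution algebra $\mathrm{Hom}_R(H^{\circ},D^{0})$. 3. More precisely, for every cointegral $\omega:D\to H$ with convolution inverse $\omega^{-1}$, the assignments $\omega^{\circ}(f)=f\circ\omega$ and $(\omega^{-1})^{\circ}(f)=f\circ\omega^{-1}$ define $R$-linear maps $H^{\circ}\to D^{0}$; the map $\omega^{\circ}$ is an integral, and it is invertible in $\mathrm{Hom}_R(H^{\circ},D^{0})$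 with inverse $(\omega^{-1})^{\circ}$. -/

import Mathlib

open scoped TensorProduct
open Coalgebra WithConv MulOpposite

universe u v w x

noncomputable section

namespace HopfDuality

section Purity

variable {R : Type u} [CommRing R]

/-- A submodule `K ⊆ M` is pure (in the sense of Cohn) if `K ⊗ N → M ⊗ N` is injective for every
`R`-module `N`.  It suffices to test modules `N` in the universe of `R`, since injectivity is
detected on finitely generated `N`; see `alphaMap_injective`, which applies it in any universe. -/
def IsPure {M : Type v} [AddCommGroup M] [Module R M] (K : Submodule R M) : Prop :=
  ∀ (N : Type u) [AddCommGroup N] [Module R N], Function.Injective (K.subtype.rTensor N)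

lemma exists_fin_sum {M : Type v} {N : Type w} [AddCommMonoid M] [Module R M] [AddCommMonoid N]
    [Module R N] (t : M ⊗[R] N) :
    ∃ (k : ℕ) (m : Fin k → M) (n : Fin k → N), t = ∑ i, m i ⊗ₜ[R] n i := by
  obtain ⟨S, rfl⟩ := TensorProduct.exists_finset t
  refine ⟨S.card, fun i => (S.equivFin.symm i).1.1, fun i => (S.equivFin.symm i).1.2, ?_⟩
  rw [← S.sum_coe_sort]
  exact (Equiv.sum_comp S.equivFin.symm
    (fun i : S => (i : M × N).1 ⊗ₜ[R] (i : M × N).2)).symm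

end Purity

section FiniteDual

variable (R : Type u) [CommRing R] {A : Type v} [Ring A] [Algebra R A]

/-- The sub-bimodule `AfA` of the dual `A^*` generated by `f`, where
`(a f)(b) = f (b a)` and `(f a)(b) = f (a b)`. -/
def bimoduleSpan (f : Module.Dual R A) : Submodule R (Module.Dual R A) :=
  Submodule.span R
    {g | ∃ x y : A, g = f ∘ₗ LinearMap.mulLeft R x ∘ₗ LinearMap.mulRight R y}

variable {R}

lemma fg_of_le [IsNoetherianRing R] {M : Type w} [AddCommGroup M] [Module R M]
    {P Q : Submodule R M} (h : P ≤ Q) (hQ : Q.FG) : P.FG := by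
  have := isNoetherian_of_fg_of_noetherian Q hQ
  have hfg := (IsNoetherian.noetherian (P.comap Q.subtype)).map Q.subtype
  rwa [Submodule.map_comap_subtype, inf_eq_right.2 h] at hfg

variable (R A)

/-- The finite dual `A° = {f ∈ A^* | AfA is finitely generated over R}` of an algebra over a
noetherian ring. -/
def finiteDual [IsNoetherianRing R] : Submodule R (Module.Dual R A) where
  carrier := {f | (bimoduleSpan R f).FG}
  zero_mem' := by
    have h : bimoduleSpan R (0 : Module.Dual R A) ≤ ⊥ := by
      refine Submodule.span_le.2 ?_
      rintro g ⟨x, y, rfl⟩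
      simp
    exact fg_of_le h Submodule.fg_bot
  add_mem' := by
    intro f g hf hg
    refine fg_of_le (Q := bimoduleSpan R f ⊔ bimoduleSpan R g) ?_ (hf.sup hg)
    refine Submodule.span_le.2 ?_
    rintro _ ⟨x, y, rfl⟩
    have h₁ : f ∘ₗ LinearMap.mulLeft R x ∘ₗ LinearMap.mulRight R y ∈ bimoduleSpan R f :=
      Submodule.subset_span ⟨x, y, rfl⟩
    have h₂ : g ∘ₗ LinearMap.mulLeft R x ∘ₗ LinearMap.mulRight R y ∈ bimoduleSpan R g :=
      Submodule.subset_span ⟨x, y, rfl⟩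
    exact Submodule.add_mem_sup h₁ h₂
  smul_mem' := by
    intro r f hf
    refine fg_of_le (Q := bimoduleSpan R f) ?_ hf
    refine Submodule.span_le.2 ?_
    rintro _ ⟨x, y, rfl⟩
    have h₁ : f ∘ₗ LinearMap.mulLeft R x ∘ₗ LinearMap.mulRight R y ∈ bimoduleSpan R f :=
      Submodule.subset_span ⟨x, y, rfl⟩
    exact Submodule.smul_mem _ r h₁

/-- `A` is an `α`-algebra: the finite dual `A°` is a pure submodule of `R^A`, the module of all
functions `A → R`. -/
class IsAlphaAlgebra [IsNoetherianRing R] : Prop where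
  isPure : IsPure ((finiteDual R A).map (LinearMap.ltoFun R A R R))

end FiniteDual

section FinDualAlgebra

variable (R : Type u) [CommRing R] [IsNoetherianRing R] (H : Type v) [Ring H] [Bialgebra R H]

lemma mul_mem_finiteDual {f g : WithConv (H →ₗ[R] R)} (hf : f.ofConv ∈ finiteDual R H)
    (hg : g.ofConv ∈ finiteDual R H) : (f * g).ofConv ∈ finiteDual R H := by
  let e := (WithConv.linearEquiv R (H →ₗ[R] R)).symm.toLinearMap
  let Q : Submodule R (WithConv (H →ₗ[R] R)) :=
    Submodule.map₂ (LinearMap.mul R _) ((bimoduleSpan R f.ofConv).map e)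
      ((bimoduleSpan R g.ofConv).map e)
  have hQ : Q.FG := Submodule.FG.map₂ _ (Submodule.FG.map _ hf) (Submodule.FG.map _ hg)
  refine fg_of_le (Q := Q.map (WithConv.linearEquiv R (H →ₗ[R] R)).toLinearMap) ?_ (hQ.map _)
  refine Submodule.span_le.2 ?_
  rintro _ ⟨x, y, rfl⟩
  have key : ∀ s t : H ⊗[R] H, (toConv (LinearMap.mul' R R ∘ₗ
      TensorProduct.map f.ofConv g.ofConv ∘ₗ LinearMap.mulLeft R s ∘ₗ LinearMap.mulRight R t ∘ₗ
      comul) : WithConv (H →ₗ[R] R)) ∈ Q := by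
    intro s t
    induction s with
    | zero => simp
    | add s₁ s₂ h₁ h₂ =>
      convert Q.add_mem h₁ h₂ using 1
      ext b; simp [add_mul]
    | tmul x₁ x₂ =>
      induction t with
      | zero => simp
      | add s₁ s₂ h₁ h₂ =>
        convert Q.add_mem h₁ h₂ using 1
        ext b; simp [mul_add]
      | tmul y₁ y₂ =>
        have h₁ : f.ofConv ∘ₗ LinearMap.mulLeft R x₁ ∘ₗ LinearMap.mulRight R y₁ ∈
            bimoduleSpan R f.ofConv := Submodule.subset_span ⟨x₁, y₁, rfl⟩
        have h₂ : g.ofConv ∘ₗ LinearMap.mulLeft R x₂ ∘ₗ LinearMap.mulRight R y₂ ∈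
            bimoduleSpan R g.ofConv := Submodule.subset_span ⟨x₂, y₂, rfl⟩
        have h₃ := Submodule.apply_mem_map₂ (LinearMap.mul R (WithConv (H →ₗ[R] R)))
          (Submodule.mem_map_of_mem (f := e) h₁) (Submodule.mem_map_of_mem (f := e) h₂)
        refine (congrArg (· ∈ Q) (WithConv.ext (LinearMap.ext fun b => ?_))).mpr h₃
        simp only [LinearMap.mul_apply', LinearMap.convMul_apply, LinearMap.comp_apply, e]
        generalize (comul b : H ⊗[R] H) = z
        induction z with
        | zero => simp
        | add z₁ z₂ h₁ h₂ => simp only [map_add, h₁, h₂]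
        | tmul a c => simp
  refine ⟨_, key (comul x) (comul y), ?_⟩
  ext b
  simp [LinearMap.convMul_def]

lemma one_mem_finiteDual : (1 : WithConv (H →ₗ[R] R)).ofConv ∈ finiteDual R H := by
  refine fg_of_le (Q := Submodule.span R {(counit : H →ₗ[R] R)}) ?_
    (Submodule.fg_span_singleton _)
  refine Submodule.span_le.2 ?_
  rintro _ ⟨x, y, rfl⟩
  refine Submodule.mem_span_singleton.2 ⟨counit x * counit y, ?_⟩
  ext b
  simp [LinearMap.convOne_def]
  ring

/-- The finite dual `H°` of a bialgebra, as a subalgebra of the convolution algebra `H^*`. -/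
def finDual : Subalgebra R (WithConv (H →ₗ[R] R)) where
  carrier := {f | f.ofConv ∈ finiteDual R H}
  mul_mem' := mul_mem_finiteDual R H
  one_mem' := one_mem_finiteDual R H
  add_mem' := fun hf hg => (finiteDual R H).add_mem hf hg
  zero_mem' := (finiteDual R H).zero_mem
  algebraMap_mem' := fun r => by
    rw [Algebra.algebraMap_eq_smul_one]
    exact (finiteDual R H).smul_mem r (one_mem_finiteDual R H)

/-- The type of elements of the finite dual `H°`, an algebra under convolution. -/
def FinDual : Type (max u v) := ↥(finDual R H)

instance : Ring (FinDual R H) := inferInstanceAs (Ring ↥(finDual R H))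

instance : Algebra R (FinDual R H) := inferInstanceAs (Algebra R ↥(finDual R H))

variable {R H}

/-- The element of `H°` given by a functional in the finite dual. -/
def FinDual.mk (f : H →ₗ[R] R) (hf : f ∈ finiteDual R H) : FinDual R H := ⟨toConv f, hf⟩

/-- The underlying functional of `f ∈ H°`; its value `FinDual.eval f h` at `h` is the pairing
`<h, f> = f h`. -/
def FinDual.eval : FinDual R H →ₗ[R] (H →ₗ[R] R) :=
  (WithConv.linearEquiv R (H →ₗ[R] R)).toLinearMap ∘ₗ (finDual R H).val.toLinearMap

@[simp] lemma FinDual.eval_mk (f : H →ₗ[R] R) (hf : f ∈ finiteDual R H) :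
    FinDual.eval (FinDual.mk f hf) = f := rfl

lemma FinDual.eval_mem (f : FinDual R H) : FinDual.eval f ∈ finiteDual R H := f.2

lemma FinDual.ext {f g : FinDual R H} (h : ∀ a, FinDual.eval f a = FinDual.eval g a) : f = g :=
  Subtype.ext (WithConv.ext (LinearMap.ext h))

variable (R H)

/-- The canonical map `α_N : N ⊗ H° → Hom_R(H, N)`, `n ⊗ f ↦ [h ↦ f(h) n]`. -/
def alphaMap (N : Type w) [AddCommMonoid N] [Module R N] :
    N ⊗[R] FinDual R H →ₗ[R] (H →ₗ[R] N) :=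
  dualTensorHom R H N ∘ₗ (TensorProduct.comm R N (Module.Dual R H)).toLinearMap ∘ₗ
    FinDual.eval.lTensor N

variable {R H}

@[simp] lemma alphaMap_tmul {N : Type w} [AddCommMonoid N] [Module R N] (n : N)
    (f : FinDual R H) (h : H) : alphaMap R H N (n ⊗ₜ f) h = FinDual.eval f h • n := by
  simp [alphaMap]

lemma alphaMap_rTensor {N : Type w} [AddCommMonoid N] [Module R N] {P : Type x}
    [AddCommMonoid P] [Module R P] (p : N →ₗ[R] P) (t : N ⊗[R] FinDual R H) (h : H) :
    alphaMap R H P (p.rTensor _ t) h = p (alphaMap R H N t h) := by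
  induction t with
  | zero => simp
  | add a b ha hb => simp [ha, hb]
  | tmul n f => simp

/-- Evaluation `R^X ⊗ N → N^X`. -/
def piEval (X : Type v) (N : Type w) [AddCommGroup N] [Module R N] :
    (X → R) ⊗[R] N →ₗ[R] (X → N) :=
  LinearMap.pi fun x => (TensorProduct.lid R N).toLinearMap ∘ₗ (LinearMap.proj x).rTensor N

lemma piEval_injective (X : Type v) (N : Type w) [AddCommGroup N] [Module R N] :
    Function.Injective (piEval (R := R) X N) := by
  rw [injective_iff_map_eq_zero]
  intro t ht
  obtain ⟨k, r, n, rfl⟩ := exists_fin_sum t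
  let φ : (Fin k → R) →ₗ[R] N := Fintype.linearCombination R n
  obtain ⟨l, b, hb⟩ := Submodule.fg_iff_exists_fin_generating_family.1
    (IsNoetherian.noetherian (LinearMap.ker φ))
  have h1 : ∀ x, (fun j => r j x) ∈ Submodule.span R (Set.range b) := by
    intro x
    rw [hb, LinearMap.mem_ker]
    simpa [piEval, φ, Fintype.linearCombination_apply] using congrFun ht x
  simp_rw [Submodule.mem_span_range_iff_exists_fun] at h1
  choose s hs using h1
  have h2 : ∀ j, r j = ∑ i, b i j • (fun x => s x i) := by
    intro j
    ext x
    have := congrFun (hs x) j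
    simp only [Finset.sum_apply, Pi.smul_apply, smul_eq_mul] at this ⊢
    rw [← this]
    exact Finset.sum_congr rfl fun i _ => mul_comm _ _
  have h3 : ∀ i, ∑ j, b i j • n j = 0 := by
    intro i
    have : b i ∈ LinearMap.ker φ := hb ▸ Submodule.subset_span ⟨i, rfl⟩
    simpa [φ, Fintype.linearCombination_apply] using this
  calc ∑ j, r j ⊗ₜ[R] n j
      = ∑ j, ∑ i, (fun x => s x i) ⊗ₜ[R] (b i j • n j) := by
        refine Finset.sum_congr rfl fun j _ => ?_
        conv_lhs => rw [h2 j, TensorProduct.sum_tmul]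
        exact Finset.sum_congr rfl fun i _ => TensorProduct.smul_tmul _ _ _
    _ = ∑ i, (fun x => s x i) ⊗ₜ[R] (∑ j, b i j • n j) := by
        rw [Finset.sum_comm]
        exact Finset.sum_congr rfl fun i _ => (TensorProduct.tmul_sum _ _ _).symm
    _ = 0 := by simp [h3]

lemma alphaMap_injective_aux [IsAlphaAlgebra R H] (N : Type u) [AddCommGroup N] [Module R N] :
    Function.Injective (alphaMap R H N) := by
  let K := (finiteDual R H).map (LinearMap.ltoFun R H R R)
  let i : FinDual R H →ₗ[R] K :=
    { toFun := fun f => ⟨FinDual.eval f, FinDual.eval f, f.eval_mem, rfl⟩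
      map_add' := fun _ _ => rfl
      map_smul' := fun _ _ => rfl }
  let j : K →ₗ[R] FinDual R H :=
    { toFun := fun f => FinDual.mk f.2.choose f.2.choose_spec.1
      map_add' := fun f g => FinDual.ext fun a => by
        have h1 := congrFun f.2.choose_spec.2 a
        have h2 := congrFun g.2.choose_spec.2 a
        have h3 := congrFun (f + g).2.choose_spec.2 a
        exact h3.trans (congrArg₂ (· + ·) h1 h2).symm
      map_smul' := fun r g => FinDual.ext fun a => by
        have h2 := congrFun g.2.choose_spec.2 a
        have h3 := congrFun (r • g).2.choose_spec.2 a
        exact h3.trans (congrArg (r • ·) h2).symm }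
  have hji : j ∘ₗ i = LinearMap.id := by
    ext1 f
    refine FinDual.ext fun a => ?_
    exact congrFun (i f).2.choose_spec.2 a
  have hi : Function.Injective (i.rTensor N) := by
    refine Function.LeftInverse.injective (g := j.rTensor N) fun t => ?_
    rw [← LinearMap.rTensor_comp_apply, hji, LinearMap.rTensor_id_apply]
  have hall : Function.Injective (piEval (R := R) H N ∘ₗ K.subtype.rTensor N ∘ₗ i.rTensor N ∘ₗ
      (TensorProduct.comm R N (FinDual R H)).toLinearMap) := by
    simp only [LinearMap.coe_comp, LinearEquiv.coe_coe]
    exact (piEval_injective H N).comp ((IsAlphaAlgebra.isPure N).comp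
      (hi.comp (TensorProduct.comm R N (FinDual R H)).injective))
  have heq : LinearMap.ltoFun R H N R ∘ₗ alphaMap R H N = piEval (R := R) H N ∘ₗ
      K.subtype.rTensor N ∘ₗ i.rTensor N ∘ₗ
        (TensorProduct.comm R N (FinDual R H)).toLinearMap := by
    ext n f a
    simp [piEval]
    rfl
  rw [← heq, LinearMap.coe_comp] at hall
  exact Function.Injective.of_comp hall

lemma alphaMap_injective_group [IsAlphaAlgebra R H] (N : Type w) [AddCommGroup N] [Module R N] :
    Function.Injective (alphaMap R H N) := by
  rw [injective_iff_map_eq_zero]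
  intro t ht
  obtain ⟨k, n, f, rfl⟩ := exists_fin_sum t
  let φ : (Fin k → R) →ₗ[R] N := Fintype.linearCombination R n
  let ψ : ((Fin k → R) ⧸ LinearMap.ker φ) →ₗ[R] N := (LinearMap.ker φ).liftQ φ le_rfl
  have hψ : Function.Injective ψ := by
    rw [← LinearMap.ker_eq_bot]
    exact Submodule.ker_liftQ_eq_bot _ _ _ le_rfl
  let t' : ((Fin k → R) ⧸ LinearMap.ker φ) ⊗[R] FinDual R H :=
    ∑ i, (LinearMap.ker φ).mkQ (Pi.single i 1) ⊗ₜ f i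
  have h1 : ψ.rTensor _ t' = ∑ i, n i ⊗ₜ[R] f i := by
    simp [t', ψ, φ, Fintype.linearCombination_apply_single]
  have h2 : t' = 0 := by
    apply alphaMap_injective_aux
    ext h
    apply hψ
    rw [← alphaMap_rTensor, h1, ht]
    simp
  rw [← h1, h2, map_zero]

lemma alphaMap_injective [IsAlphaAlgebra R H] (N : Type w) [AddCommMonoid N] [Module R N] :
    Function.Injective (alphaMap R H N) :=
  letI : AddCommGroup N := Module.addCommMonoidToAddCommGroup R
  alphaMap_injective_group N

/-- If all values of `α_M t` lie in the image of an injective map `j : K → M`, then `t` comes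
from `K ⊗ H°`. -/
lemma exists_rTensor_eq_group [IsAlphaAlgebra R H] {K : Type w} {M : Type x} [AddCommGroup K]
    [Module R K] [AddCommGroup M] [Module R M] (j : K →ₗ[R] M) (t : M ⊗[R] FinDual R H)
    (ht : ∀ h, alphaMap R H M t h ∈ LinearMap.range j) : ∃ t', j.rTensor _ t' = t := by
  have hex := rTensor_exact (FinDual R H) (LinearMap.exact_map_mkQ_range j)
    (LinearMap.range j).mkQ_surjective
  refine (hex t).1 ?_
  apply alphaMap_injective
  ext h
  rw [alphaMap_rTensor]
  simpa using ht h

lemma exists_rTensor_eq [IsAlphaAlgebra R H] {K : Type w} {M : Type x} [AddCommMonoid K]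
    [Module R K] [AddCommMonoid M] [Module R M] (j : K →ₗ[R] M) (t : M ⊗[R] FinDual R H)
    (ht : ∀ h, ∃ k, j k = alphaMap R H M t h) : ∃ t', j.rTensor _ t' = t :=
  letI : AddCommGroup K := Module.addCommMonoidToAddCommGroup R
  letI : AddCommGroup M := Module.addCommMonoidToAddCommGroup R
  exists_rTensor_eq_group j t ht

lemma eval_mul (f g : FinDual R H) (h : H) : FinDual.eval (f * g) h =
    LinearMap.mul' R R (TensorProduct.map (FinDual.eval f) (FinDual.eval g) (comul h)) := rfl

lemma eval_one (h : H) : FinDual.eval (1 : FinDual R H) h = counit h := rfl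

lemma alphaMap_one (B : Type w) [Semiring B] [Algebra R B] :
    toConv (alphaMap R H B 1) = 1 := by
  ext h
  rw [Algebra.TensorProduct.one_def]
  simp only [alphaMap_tmul]
  rw [LinearMap.convOne_def, eval_one]
  simp [Algebra.algebraMap_eq_smul_one]

lemma alphaMap_mul (B : Type w) [Semiring B] [Algebra R B] (s t : B ⊗[R] FinDual R H) :
    toConv (alphaMap R H B (s * t)) =
      toConv (alphaMap R H B s) * toConv (alphaMap R H B t) := by
  induction s with
  | zero => simp
  | add a b ha hb => simp only [add_mul, map_add, toConv_add, ha, hb]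
  | tmul a f =>
    induction t with
    | zero => simp
    | add a b ha hb => simp only [mul_add, map_add, toConv_add, ha, hb]
    | tmul b g =>
      ext h
      simp only [Algebra.TensorProduct.tmul_mul_tmul, alphaMap_tmul,
        LinearMap.convMul_apply]
      rw [eval_mul]
      generalize (comul h : H ⊗[R] H) = z
      induction z with
      | zero => simp
      | add z₁ z₂ h₁ h₂ => simp only [map_add, add_smul, h₁, h₂]
      | tmul c d => simp [smul_smul, mul_comm]

end FinDualAlgebra

section Rational

variable {R : Type u} [CommRing R] [IsNoetherianRing R] {H : Type v} [Ring H] [Bialgebra R H]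

/-- For a left `H`-module `M`, given by `act : H → End_R(M)`, the `H°`-rational submodule
`Rat(M) = {m | the map h ↦ h m lies in the image of α_M : M ⊗ H° → Hom_R(H, M)}`. -/
def ratSubmodule {M : Type w} [AddCommMonoid M] [Module R M] (act : H →ₐ[R] Module.End R M) :
    Submodule R M :=
  (LinearMap.range (alphaMap R H M)).comap act.toLinearMap.flip

lemma mem_ratSubmodule {M : Type w} [AddCommMonoid M] [Module R M]
    {act : H →ₐ[R] Module.End R M} {m : M} :
    m ∈ ratSubmodule act ↔ ∃ t, ∀ h, alphaMap R H M t h = act h m :=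
  ⟨fun ⟨t, ht⟩ => ⟨t, fun h => LinearMap.congr_fun ht h⟩,
    fun ⟨t, ht⟩ => ⟨t, LinearMap.ext ht⟩⟩

/-- The coaction `K → K ⊗ H°` of an action map `a : K → Hom_R(H, K)` with values in the image of
the injective map `α_K`: it sends `k` to the unique `t` with `α_K t = a k`. -/
def coactionOfRange [IsAlphaAlgebra R H] {K : Type w} [AddCommMonoid K] [Module R K]
    (a : K →ₗ[R] (H →ₗ[R] K)) (ha : ∀ k, a k ∈ LinearMap.range (alphaMap R H K)) :
    K →ₗ[R] K ⊗[R] FinDual R H :=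
  (LinearEquiv.ofInjective (alphaMap R H K) (alphaMap_injective K)).symm.toLinearMap ∘ₗ
    a.codRestrict _ ha

lemma alphaMap_coactionOfRange [IsAlphaAlgebra R H] {K : Type w} [AddCommMonoid K] [Module R K]
    (a : K →ₗ[R] (H →ₗ[R] K)) (ha : ∀ k, a k ∈ LinearMap.range (alphaMap R H K)) (k : K) :
    alphaMap R H K (coactionOfRange a ha k) = a k := by
  have := (LinearEquiv.ofInjective (alphaMap R H K) (alphaMap_injective K)).apply_symm_apply
    (a.codRestrict _ ha k)
  exact congrArg Subtype.val this

lemma comp_mulRight_mem_finiteDual {f : H →ₗ[R] R} (hf : f ∈ finiteDual R H) (b : H) :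
    f ∘ₗ LinearMap.mulRight R b ∈ finiteDual R H := by
  refine fg_of_le (Q := bimoduleSpan R f) ?_ hf
  refine Submodule.span_le.2 ?_
  rintro _ ⟨x, y, rfl⟩
  refine Submodule.subset_span ⟨x, y * b, ?_⟩
  ext a
  simp [mul_assoc]

lemma comp_mulLeft_mem_finiteDual {f : H →ₗ[R] R} (hf : f ∈ finiteDual R H) (b : H) :
    f ∘ₗ LinearMap.mulLeft R b ∈ finiteDual R H := by
  refine fg_of_le (Q := bimoduleSpan R f) ?_ hf
  refine Submodule.span_le.2 ?_
  rintro _ ⟨x, y, rfl⟩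
  refine Submodule.subset_span ⟨b * x, y, ?_⟩
  ext a
  simp

variable (R H)

/-- The left regular action of `H` on `H°`, `(b f)(a) = f (a b)`. -/
def regAct : FinDual R H →ₗ[R] (H →ₗ[R] FinDual R H) :=
  LinearMap.mk₂ R
    (fun f b => FinDual.mk (FinDual.eval f ∘ₗ LinearMap.mulRight R b)
      (comp_mulRight_mem_finiteDual f.eval_mem b))
    (fun _ _ _ => FinDual.ext fun _ => rfl)
    (fun _ _ _ => FinDual.ext fun _ => rfl)
    (fun f b c => FinDual.ext fun a => by
      change FinDual.eval f (a * (b + c)) = FinDual.eval f (a * b) + FinDual.eval f (a * c)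
      rw [mul_add, map_add])
    (fun r f b => FinDual.ext fun a => by
      change FinDual.eval f (a * (r • b)) = r • FinDual.eval f (a * b)
      rw [mul_smul_comm, map_smul])

variable {R H}

@[simp] lemma eval_regAct (f : FinDual R H) (b a : H) :
    FinDual.eval (regAct R H f b) a = FinDual.eval f (a * b) := rfl

lemma regAct_mem_range [IsAlphaAlgebra R H] (f : FinDual R H) :
    regAct R H f ∈ LinearMap.range (alphaMap R H (FinDual R H)) := by
  obtain ⟨k, g, hg⟩ := Submodule.fg_iff_exists_fin_generating_family.1 f.eval_mem
  have hgmem : ∀ i, g i ∈ finiteDual R H := by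
    intro i
    have hi : g i ∈ bimoduleSpan R (FinDual.eval f) := hg ▸ Submodule.subset_span ⟨i, rfl⟩
    have hle : bimoduleSpan R (FinDual.eval f) ≤ finiteDual R H := by
      refine Submodule.span_le.2 ?_
      rintro _ ⟨x, y, rfl⟩
      have h := comp_mulRight_mem_finiteDual (comp_mulLeft_mem_finiteDual f.eval_mem x) y
      rwa [LinearMap.comp_assoc] at h
    exact hle hi
  have h1 : ∀ a : H, FinDual.eval f ∘ₗ LinearMap.mulLeft R a ∈ Submodule.span R (Set.range g) := by
    intro a
    rw [hg]
    refine Submodule.subset_span ⟨a, 1, ?_⟩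
    ext b
    simp
  simp_rw [Submodule.mem_span_range_iff_exists_fun] at h1
  choose c hc using h1
  let j : FinDual R H →ₗ[R] (H → R) := LinearMap.ltoFun R H R R ∘ₗ FinDual.eval
  let t : (H → R) ⊗[R] FinDual R H :=
    ∑ i, (fun a => c a i) ⊗ₜ[R] FinDual.mk (g i) (hgmem i)
  have ht : ∀ b, alphaMap R H (H → R) t b = j (regAct R H f b) := by
    intro b
    ext a
    have h2 := LinearMap.congr_fun (hc a) b
    simp only [t, map_sum, LinearMap.sum_apply, alphaMap_tmul, FinDual.eval_mk, Finset.sum_apply,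
      Pi.smul_apply, smul_eq_mul]
    simp only [LinearMap.sum_apply, LinearMap.smul_apply, smul_eq_mul, LinearMap.comp_apply,
      LinearMap.mulLeft_apply] at h2
    change _ = FinDual.eval f (a * b)
    rw [← h2]
    exact Finset.sum_congr rfl fun i _ => mul_comm _ _
  obtain ⟨t', ht'⟩ := exists_rTensor_eq j t fun b => ⟨_, (ht b).symm⟩
  refine ⟨t', LinearMap.ext fun b => ?_⟩
  have hj : Function.Injective j := fun f g h => FinDual.ext fun a => congrFun h a
  apply hj
  rw [← alphaMap_rTensor, ht', ht]

/-- The comultiplication of `H°`, dual to the multiplication of `H`: `Δ f` is the unique element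
`∑ f₁ ⊗ f₂` of `H° ⊗ H°` with `∑ f₁(a) f₂(b) = f (a b)`. -/
def finDualComul [IsAlphaAlgebra R H] : FinDual R H →ₗ[R] FinDual R H ⊗[R] FinDual R H :=
  coactionOfRange (regAct R H) regAct_mem_range

lemma alphaMap_finDualComul [IsAlphaAlgebra R H] (f : FinDual R H) :
    alphaMap R H _ (finDualComul f) = regAct R H f :=
  alphaMap_coactionOfRange _ _ f

/-- The counit of `H°`, `f ↦ f 1`. -/
def finDualCounit : FinDual R H →ₗ[R] R := FinDual.eval.flip 1

lemma finDualCounit_apply (f : FinDual R H) : finDualCounit f = FinDual.eval f 1 := rfl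

lemma alphaMap_alphaMap_lTensor_comul [IsAlphaAlgebra R H] {K : Type w} [AddCommMonoid K]
    [Module R K] (t : K ⊗[R] FinDual R H) (b c : H) :
    alphaMap R H K (alphaMap R H _ ((TensorProduct.assoc R K (FinDual R H) (FinDual R H)).symm
      (finDualComul.lTensor K t)) b) c = alphaMap R H K t (c * b) := by
  induction t with
  | zero => simp
  | add s t hs ht => simp only [map_add, LinearMap.add_apply, hs, ht]
  | tmul k f =>
    have h1 : ∀ z : FinDual R H ⊗[R] FinDual R H,
        alphaMap R H K (alphaMap R H _ ((TensorProduct.assoc R K (FinDual R H)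
          (FinDual R H)).symm (k ⊗ₜ z)) b) c =
          FinDual.eval (alphaMap R H _ z b) c • k := by
      intro z
      induction z with
      | zero => simp
      | add s t hs ht =>
        simp only [TensorProduct.tmul_add, map_add, LinearMap.add_apply, add_smul, hs, ht]
      | tmul f g => simp [smul_smul]
    rw [LinearMap.lTensor_tmul, h1, alphaMap_finDualComul, eval_regAct, alphaMap_tmul]

/-- Coassociativity of a coaction coming from an associative action. -/
lemma coactionOfRange_coassoc [IsAlphaAlgebra R H] {K : Type w} [AddCommMonoid K] [Module R K]
    (a : K →ₗ[R] (H →ₗ[R] K)) (ha : ∀ k, a k ∈ LinearMap.range (alphaMap R H K))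
    (hmul : ∀ k b c, a k (c * b) = a (a k b) c) (k : K) :
    TensorProduct.assoc R K (FinDual R H) (FinDual R H)
      ((coactionOfRange a ha).rTensor _ (coactionOfRange a ha k)) =
      finDualComul.lTensor K (coactionOfRange a ha k) := by
  rw [← LinearEquiv.eq_symm_apply]
  apply alphaMap_injective
  ext b : 1
  apply alphaMap_injective
  ext c : 1
  rw [alphaMap_alphaMap_lTensor_comul, alphaMap_rTensor, alphaMap_coactionOfRange,
    alphaMap_coactionOfRange, hmul]

lemma lTensor_counit_eq {K : Type w} [AddCommMonoid K] [Module R K] (t : K ⊗[R] FinDual R H) :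
    finDualCounit.lTensor K t = alphaMap R H K t 1 ⊗ₜ[R] (1 : R) := by
  induction t with
  | zero => simp
  | add s t hs ht => simp only [map_add, LinearMap.add_apply, TensorProduct.add_tmul, hs, ht]
  | tmul k f =>
    rw [LinearMap.lTensor_tmul, alphaMap_tmul, TensorProduct.smul_tmul, finDualCounit_apply,
      smul_eq_mul, mul_one]

instance [IsAlphaAlgebra R H] : Coalgebra R (FinDual R H) where
  comul := finDualComul
  counit := finDualCounit
  coassoc := LinearMap.ext fun f =>
    coactionOfRange_coassoc (regAct R H) regAct_mem_range
      (fun f b c => FinDual.ext fun a => by simp [mul_assoc]) f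
  rTensor_counit_comp_comul := by
    ext1 f
    apply (TensorProduct.lid R (FinDual R H)).injective
    refine FinDual.ext fun a => ?_
    have h1 : FinDual.eval.flip a ∘ₗ (TensorProduct.lid R (FinDual R H)).toLinearMap ∘ₗ
        finDualCounit.rTensor _ = finDualCounit ∘ₗ (alphaMap R H (FinDual R H)).flip a :=
      TensorProduct.ext' fun f g => by simp [finDualCounit_apply, mul_comm]
    refine (LinearMap.congr_fun h1 (finDualComul f)).trans ?_
    simp only [LinearMap.comp_apply, LinearMap.flip_apply, alphaMap_finDualComul]
    simp [finDualCounit_apply]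
  lTensor_counit_comp_comul := by
    ext1 f
    rw [LinearMap.comp_apply, lTensor_counit_eq, alphaMap_finDualComul, LinearMap.flip_apply,
      TensorProduct.mk_apply]
    congr 1
    exact FinDual.ext fun a => by simp

lemma finDual_comul_def [IsAlphaAlgebra R H] (f : FinDual R H) :
    comul (R := R) f = finDualComul f := rfl

lemma finDual_counit_def [IsAlphaAlgebra R H] (f : FinDual R H) :
    counit (R := R) f = FinDual.eval f 1 := rfl

/-- Multiplicativity of a coaction coming from a module algebra. -/
lemma coactionOfRange_mul [IsAlphaAlgebra R H] {B : Type w} [Semiring B] [Algebra R B]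
    (a : B →ₗ[R] (H →ₗ[R] B)) (ha : ∀ k, a k ∈ LinearMap.range (alphaMap R H B))
    (hmul : ∀ k l, toConv (a (k * l)) = toConv (a k) * toConv (a l)) (k l : B) :
    coactionOfRange a ha (k * l) = coactionOfRange a ha k * coactionOfRange a ha l := by
  apply alphaMap_injective
  apply WithConv.toConv_injective
  rw [alphaMap_mul, alphaMap_coactionOfRange, alphaMap_coactionOfRange, alphaMap_coactionOfRange,
    hmul]

lemma coactionOfRange_one [IsAlphaAlgebra R H] {B : Type w} [Semiring B] [Algebra R B]
    (a : B →ₗ[R] (H →ₗ[R] B)) (ha : ∀ k, a k ∈ LinearMap.range (alphaMap R H B))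
    (hone : toConv (a 1) = 1) : coactionOfRange a ha 1 = 1 := by
  apply alphaMap_injective
  apply WithConv.toConv_injective
  rw [alphaMap_one, alphaMap_coactionOfRange, hone]

lemma regAct_mul (f g : FinDual R H) :
    toConv (regAct R H (f * g)) = toConv (regAct R H f) * toConv (regAct R H g) := by
  apply WithConv.ext
  ext b : 1
  refine FinDual.ext fun a => ?_
  simp only [LinearMap.convMul_apply, eval_regAct, eval_mul]
  rw [Bialgebra.comul_mul]
  generalize (comul b : H ⊗[R] H) = z
  induction z with
  | zero => simp
  | add z₁ z₂ h₁ h₂ => simp only [map_add, LinearMap.add_apply, mul_add, h₁, h₂]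
  | tmul b₁ b₂ =>
    simp only [TensorProduct.map_tmul, LinearMap.mul'_apply, eval_mul]
    generalize (comul a : H ⊗[R] H) = y
    induction y with
    | zero => simp
    | add z₁ z₂ h₁ h₂ => simp only [map_add, add_mul, h₁, h₂]
    | tmul a₁ a₂ => simp

lemma regAct_one : toConv (regAct R H 1) = 1 := by
  apply WithConv.ext
  ext b : 1
  refine FinDual.ext fun a => ?_
  simp [eval_one, Algebra.algebraMap_eq_smul_one, LinearMap.convOne_def, mul_comm]

lemma finDual_counit_mul [IsAlphaAlgebra R H] (f g : FinDual R H) :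
    counit (R := R) (f * g) = counit (R := R) f * counit (R := R) g := by
  rw [finDual_counit_def, finDual_counit_def, finDual_counit_def, eval_mul, Bialgebra.comul_one,
    Algebra.TensorProduct.one_def, TensorProduct.map_tmul, LinearMap.mul'_apply]

lemma finDual_comul_one [IsAlphaAlgebra R H] : comul (R := R) (1 : FinDual R H) = 1 :=
  coactionOfRange_one (regAct R H) regAct_mem_range regAct_one

lemma finDual_comul_mul [IsAlphaAlgebra R H] (f g : FinDual R H) :
    comul (R := R) (f * g) = comul (R := R) f * comul (R := R) g :=
  coactionOfRange_mul (regAct R H) regAct_mem_range regAct_mul f g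

/-- For a bialgebra `H` which is an `α`-algebra, the finite dual `H°` is a bialgebra. -/
instance [IsAlphaAlgebra R H] : Bialgebra R (FinDual R H) :=
  Bialgebra.mk' R (FinDual R H)
    (by rw [finDual_counit_def, eval_one, Bialgebra.counit_one])
    (finDual_counit_mul _ _) finDual_comul_one (finDual_comul_mul _ _)

end Rational

section Comodule

variable (R : Type u) [CommRing R] (H : Type v) [Ring H] [Bialgebra R H]
  (B : Type w) [Ring B] [Algebra R B]

/-- A right `H`-comodule algebra: an algebra `B` with a coassociative and counital coaction
`ϱ : B → B ⊗ H` that is an algebra morphism. -/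
class RightComoduleAlgebra where
  /-- The coaction `ϱ`. -/
  coact : B →ₗ[R] B ⊗[R] H
  coassoc : ∀ b, TensorProduct.assoc R B H H (coact.rTensor H (coact b)) =
    (comul : H →ₗ[R] H ⊗[R] H).lTensor B (coact b)
  counit : ∀ b, TensorProduct.rid R B ((Coalgebra.counit : H →ₗ[R] R).lTensor B (coact b)) = b
  coact_one : coact 1 = 1
  coact_mul : ∀ a b, coact (a * b) = coact a * coact b

/-- The coaction of a right `H`-comodule algebra, as an algebra morphism. -/
def coactAlgHom [RightComoduleAlgebra R H B] : B →ₐ[R] B ⊗[R] H :=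
  AlgHom.ofLinearMap RightComoduleAlgebra.coact RightComoduleAlgebra.coact_one
    RightComoduleAlgebra.coact_mul

/-- The subalgebra of coinvariants `B^{co H} = {b | ϱ b = b ⊗ 1}`. -/
def coinvariants [RightComoduleAlgebra R H B] : Subalgebra R B :=
  AlgHom.equalizer (coactAlgHom R H B) Algebra.TensorProduct.includeLeft

lemma mem_coinvariants [RightComoduleAlgebra R H B] {b : B} :
    b ∈ coinvariants R H B ↔ RightComoduleAlgebra.coact (R := R) (H := H) b = b ⊗ₜ 1 :=
  Iff.rfl

variable {R B}

/-- An algebra map `ι : A → B` into a right `H`-comodule algebra is a right `H`-extension if it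
identifies `A` with the coinvariants `B^{co H}`. -/
structure IsRightExtension [RightComoduleAlgebra R H B] {A : Type x} [Ring A] [Algebra R A]
    (ι : A →ₐ[R] B) : Prop where
  injective : Function.Injective ι
  range_eq : ι.range = coinvariants R H B

variable {H}

/-- An integral for the right `H`-comodule algebra `B` is an `H`-colinear map `γ : H → B`. -/
def IsComoduleIntegral [RightComoduleAlgebra R H B] (γ : H →ₗ[R] B) : Prop :=
  ∀ h, RightComoduleAlgebra.coact (R := R) (H := H) (γ h) =
    γ.rTensor H (comul h)

variable (H)

/-- A right `H`-extension is cleft if `B` admits a convolution-invertible integral. -/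
structure IsCleftExtension [RightComoduleAlgebra R H B] {A : Type x} [Ring A] [Algebra R A]
    (ι : A →ₐ[R] B) : Prop extends IsRightExtension H ι where
  exists_integral : ∃ γ : H →ₗ[R] B, IsComoduleIntegral γ ∧ IsUnit (toConv γ)

end Comodule

section ModuleCoalgebra

variable (R : Type u) [CommRing R] (H : Type v) [Ring H] [Bialgebra R H]
  (D : Type w) [AddCommGroup D] [Module R D] [Module Hᵐᵒᵖ D] [IsScalarTower R Hᵐᵒᵖ D]

/-- The right action `(d, h) ↦ d h` as a bilinear map.  Right `H`-modules are modules over the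
opposite algebra of `H`. -/
def rightAction : D →ₗ[R] H →ₗ[R] D :=
  LinearMap.mk₂ R (fun d h => op h • d) (fun _ _ _ => smul_add _ _ _)
    (fun r d h => smul_comm _ r d) (fun _ _ _ => by rw [op_add, add_smul])
    (fun _ _ _ => by rw [op_smul, smul_assoc])

@[simp] lemma rightAction_apply (d : D) (h : H) : rightAction R H D d h = op h • d := rfl

/-- `D` is a right `H`-module coalgebra: `ε(d h) = ε(d) ε(h)` and
`Δ(d h) = ∑ d₁ h₁ ⊗ d₂ h₂`. -/
class IsRightModuleCoalgebra [Coalgebra R D] : Prop where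
  counit_smul : ∀ (d : D) (h : H), counit (R := R) (op h • d) = counit (R := R) d * counit h
  comul_smul : ∀ (d : D) (h : H), comul (R := R) (op h • d) =
    TensorProduct.map₂ (rightAction R H D) (rightAction R H D) (comul d) (comul h)

/-- A cointegral for the right `H`-module coalgebra `D` is an `H`-linear map `ω : D → H`. -/
def IsCointegral {R : Type u} [CommRing R] {H : Type v} [Ring H] [Bialgebra R H]
    {D : Type w} [AddCommGroup D] [Module R D] [Module Hᵐᵒᵖ D] (ω : D →ₗ[R] H) : Prop :=
  ∀ (d : D) (h : H), ω (op h • d) = ω d * h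

/-- The right `H`-coextension `D → D / D H⁺` is cocleft if `D` admits a convolution-invertible
cointegral. -/
def IsCocleft [Coalgebra R D] : Prop :=
  ∃ ω : D →ₗ[R] H, IsCointegral ω ∧ IsUnit (toConv ω)

/-- The submodule `D H⁺` of `D`, where `H⁺ = ker ε`. -/
def augSubmodule : Submodule R D :=
  Submodule.span R {x | ∃ (d : D) (h : H), counit (R := R) h = 0 ∧ op h • d = x}

lemma mkQ_op_smul (d : D) (h : H) : (augSubmodule R H D).mkQ (op h • d) =
    counit (R := R) h • (augSubmodule R H D).mkQ d := by
  rw [← map_smul, ← sub_eq_zero, ← map_sub, Submodule.mkQ_apply, Submodule.Quotient.mk_eq_zero]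
  refine Submodule.subset_span ⟨d, h - counit (R := R) h • 1, ?_, ?_⟩
  · simp
  · rw [op_sub, op_smul, sub_smul, op_one, smul_assoc, one_smul]

lemma mul'_map_counit_comul (h : H) :
    LinearMap.mul' R R (TensorProduct.map counit counit (comul h)) = counit (R := R) h := by
  have := congrArg (fun f : WithConv (H →ₗ[R] R) => f.ofConv h)
    (mul_one (1 : WithConv (H →ₗ[R] R)))
  simpa [LinearMap.convMul_def, LinearMap.convOne_def] using this

instance [Coalgebra R D] [IsRightModuleCoalgebra R H D] : (augSubmodule R H D).IsCoideal where
  counit_eq_zero := by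
    intro x hx
    induction hx using Submodule.span_induction with
    | mem x hx =>
      obtain ⟨d, h, hh, rfl⟩ := hx
      rw [IsRightModuleCoalgebra.counit_smul, hh, mul_zero]
    | zero => simp
    | add x y _ _ hx hy => rw [map_add, hx, hy, add_zero]
    | smul r x _ hx => rw [map_smul, hx, smul_zero]
  map_mkQ_comul_eq_zero := by
    intro x hx
    induction hx using Submodule.span_induction with
    | mem x hx =>
      obtain ⟨d, h, hh, rfl⟩ := hx
      have key : ∀ (z : D ⊗[R] D) (y : H ⊗[R] H),
          TensorProduct.map (augSubmodule R H D).mkQ (augSubmodule R H D).mkQ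
            (TensorProduct.map₂ (rightAction R H D) (rightAction R H D) z y) =
          LinearMap.mul' R R (TensorProduct.map counit counit y) •
            TensorProduct.map (augSubmodule R H D).mkQ (augSubmodule R H D).mkQ z := by
        intro z y
        induction z with
        | zero => simp
        | add z₁ z₂ h₁ h₂ => simp only [map_add, LinearMap.add_apply, smul_add, h₁, h₂]
        | tmul d₁ d₂ =>
          induction y with
          | zero => simp
          | add z₁ z₂ h₁ h₂ => simp only [map_add, add_smul, h₁, h₂]
          | tmul h₁ h₂ =>
            simp only [TensorProduct.map₂_apply_tmul, rightAction_apply, TensorProduct.map_tmul,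
              mkQ_op_smul, LinearMap.mul'_apply, TensorProduct.smul_tmul_smul]
      rw [IsRightModuleCoalgebra.comul_smul, key, mul'_map_counit_comul, hh, zero_smul]
    | zero => simp
    | add x y _ _ hx hy => rw [map_add, map_add, hx, hy, add_zero]
    | smul r x _ hx => rw [map_smul, map_smul, hx, smul_zero]

/-- The quotient `C = D / D H⁺`, a right `H`-module coalgebra. -/
def CoinvQuot : Type w := D ⧸ augSubmodule R H D

instance : AddCommGroup (CoinvQuot R H D) := inferInstanceAs (AddCommGroup (D ⧸ _))

instance : Module R (CoinvQuot R H D) := inferInstanceAs (Module R (D ⧸ augSubmodule R H D))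

instance [Coalgebra R D] [IsRightModuleCoalgebra R H D] : Coalgebra R (CoinvQuot R H D) :=
  inferInstanceAs (Coalgebra R (D ⧸ augSubmodule R H D))

/-- The right `H`-coextension `π : D → C = D / D H⁺`. -/
def coextension [Coalgebra R D] [IsRightModuleCoalgebra R H D] : D →ₗc[R] CoinvQuot R H D :=
  Coalgebra.Quotient.mkQCoalgHom (augSubmodule R H D)

lemma augSubmodule_le_comap (h : Hᵐᵒᵖ) :
    augSubmodule R H D ≤ (augSubmodule R H D).comap (Algebra.lsmul R R D h) := by
  refine Submodule.span_le.2 ?_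
  rintro _ ⟨d, k, hk, rfl⟩
  refine Submodule.subset_span ⟨d, k * h.unop, ?_, ?_⟩
  · rw [Bialgebra.counit_mul, hk, zero_mul]
  · rw [op_mul, op_unop, mul_smul, Algebra.lsmul_coe]

/-- The action of `H` on `D / D H⁺` induced from that on `D`. -/
def quotAct : Hᵐᵒᵖ →+* Module.End R (CoinvQuot R H D) where
  toFun h := (augSubmodule R H D).mapQ _ (Algebra.lsmul R R D h) (augSubmodule_le_comap R H D h)
  map_one' := Submodule.linearMap_qext _ (LinearMap.ext fun d =>
    congrArg (augSubmodule R H D).mkQ (one_smul _ d))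
  map_mul' h k := Submodule.linearMap_qext _ (LinearMap.ext fun d =>
    congrArg (augSubmodule R H D).mkQ (mul_smul h k d))
  map_zero' := Submodule.linearMap_qext _ (LinearMap.ext fun d =>
    congrArg (augSubmodule R H D).mkQ (zero_smul _ d))
  map_add' h k := Submodule.linearMap_qext _ (LinearMap.ext fun d =>
    congrArg (augSubmodule R H D).mkQ (add_smul h k d))

instance : Module Hᵐᵒᵖ (CoinvQuot R H D) := Module.compHom _ (quotAct R H D)

section
variable [Coalgebra R D] [IsRightModuleCoalgebra R H D]

lemma coextension_surjective : Function.Surjective (coextension R H D) :=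
  (augSubmodule R H D).mkQ_surjective

lemma coextension_smul (h : Hᵐᵒᵖ) (d : D) :
    coextension R H D (h • d) = h • coextension R H D d := rfl

instance : IsScalarTower R Hᵐᵒᵖ (CoinvQuot R H D) where
  smul_assoc r h c := by
    obtain ⟨d, rfl⟩ := coextension_surjective R H D c
    rw [← coextension_smul, ← coextension_smul, smul_assoc, map_smul]

instance : IsRightModuleCoalgebra R H (CoinvQuot R H D) where
  counit_smul c h := by
    obtain ⟨d, rfl⟩ := coextension_surjective R H D c
    rw [← coextension_smul, CoalgHomClass.counit_comp_apply, CoalgHomClass.counit_comp_apply,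
      IsRightModuleCoalgebra.counit_smul]
  comul_smul c h := by
    obtain ⟨d, rfl⟩ := coextension_surjective R H D c
    rw [← coextension_smul, ← CoalgHomClass.map_comp_comul_apply,
      ← CoalgHomClass.map_comp_comul_apply, IsRightModuleCoalgebra.comul_smul]
    generalize (comul d : D ⊗[R] D) = z
    generalize (comul h : H ⊗[R] H) = y
    induction z with
    | zero => simp
    | add z₁ z₂ h₁ h₂ => simp only [map_add, LinearMap.add_apply, h₁, h₂]
    | tmul d₁ d₂ =>
      induction y with
      | zero => simp
      | add z₁ z₂ h₁ h₂ => simp only [map_add, h₁, h₂]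
      | tmul h₁ h₂ => simp [coextension_smul]

end

end ModuleCoalgebra

section DualAction

variable (R : Type u) [CommRing R] (H : Type v) [Ring H] [Bialgebra R H]
  (D : Type w) [AddCommGroup D] [Module R D] [Module Hᵐᵒᵖ D] [IsScalarTower R Hᵐᵒᵖ D]

/-- The left `H`-module structure `(h f)(d) = f (d h)` on `D^*`. -/
def dualAct : H →ₐ[R] Module.End R (WithConv (D →ₗ[R] R)) :=
  AlgHom.ofLinearMap
    (LinearMap.mk₂ R (fun h f => toConv (f.ofConv ∘ₗ (rightAction R H D).flip h))
      (fun h k f => WithConv.ext (LinearMap.ext fun d => by simp))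
      (fun r h f => WithConv.ext (LinearMap.ext fun d => by simp))
      (fun h f g => rfl) (fun r h f => rfl))
    (LinearMap.ext fun f => WithConv.ext (LinearMap.ext fun d =>
      congrArg f.ofConv (one_smul _ d)))
    (fun h k => LinearMap.ext fun f => WithConv.ext (LinearMap.ext fun d =>
      congrArg f.ofConv (mul_smul (op k) (op h) d)))

variable {R H D} in
@[simp] lemma dualAct_apply (h : H) (f : WithConv (D →ₗ[R] R)) (d : D) :
    (dualAct R H D h f).ofConv d = f.ofConv (op h • d) := rfl

variable [Coalgebra R D] [IsRightModuleCoalgebra R H D]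

lemma dualAct_mul (f g : WithConv (D →ₗ[R] R)) :
    toConv ((dualAct R H D).toLinearMap.flip (f * g)) =
      toConv ((dualAct R H D).toLinearMap.flip f) *
        toConv ((dualAct R H D).toLinearMap.flip g) := by
  apply WithConv.ext
  ext h : 1
  apply WithConv.ext
  ext d : 1
  change LinearMap.mul' R R (TensorProduct.map f.ofConv g.ofConv (comul (op h • d))) =
    (LinearMap.mul' R (WithConv (D →ₗ[R] R)) (TensorProduct.map
      ((dualAct R H D).toLinearMap.flip f) ((dualAct R H D).toLinearMap.flip g)
        (comul h))).ofConv d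
  rw [IsRightModuleCoalgebra.comul_smul]
  generalize (comul h : H ⊗[R] H) = y
  induction y with
  | zero => simp
  | add z₁ z₂ h₁ h₂ =>
    simp only [map_add, ofConv_add, LinearMap.add_apply, h₁, h₂]
  | tmul h₁ h₂ =>
    simp only [TensorProduct.map_tmul, LinearMap.mul'_apply, LinearMap.convMul_apply]
    generalize (comul d : D ⊗[R] D) = z
    induction z with
    | zero => simp
    | add z₁ z₂ h₁ h₂ => simp only [map_add, LinearMap.add_apply, h₁, h₂]
    | tmul d₁ d₂ => simp

lemma dualAct_one : toConv ((dualAct R H D).toLinearMap.flip 1) = 1 := by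
  apply WithConv.ext
  ext h : 1
  apply WithConv.ext
  ext d : 1
  simp [LinearMap.convOne_def, Algebra.algebraMap_eq_smul_one,
    IsRightModuleCoalgebra.counit_smul, mul_comm]

end DualAction

section RationalDual

variable (R : Type u) [CommRing R] [IsNoetherianRing R] (H : Type v) [Ring H] [Bialgebra R H]
  (D : Type w) [AddCommGroup D] [Module R D] [Module Hᵐᵒᵖ D] [IsScalarTower R Hᵐᵒᵖ D]
  [Coalgebra R D] [IsRightModuleCoalgebra R H D]

/-- `D^0 = Rat^{H°}(_H D^*)`, as a subalgebra of the convolution algebra `D^*`. -/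
def ratDual : Subalgebra R (WithConv (D →ₗ[R] R)) where
  carrier := {f | f ∈ ratSubmodule (dualAct R H D)}
  mul_mem' := by
    rintro f g ⟨s, hs⟩ ⟨t, ht⟩
    refine ⟨s * t, WithConv.toConv_injective ?_⟩
    rw [alphaMap_mul, hs, ht, dualAct_mul]
  one_mem' := ⟨1, WithConv.toConv_injective (by rw [alphaMap_one, dualAct_one])⟩
  add_mem' := fun hf hg => (ratSubmodule (dualAct R H D)).add_mem hf hg
  zero_mem' := (ratSubmodule (dualAct R H D)).zero_mem
  algebraMap_mem' := fun r => by
    rw [Algebra.algebraMap_eq_smul_one]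
    exact (ratSubmodule (dualAct R H D)).smul_mem r
      ⟨1, WithConv.toConv_injective (by rw [alphaMap_one, dualAct_one])⟩

/-- The type of elements of `D^0`, an algebra under convolution. -/
def RatDual : Type (max u w) := ↥(ratDual R H D)

instance : Ring (RatDual R H D) := inferInstanceAs (Ring ↥(ratDual R H D))

instance : Algebra R (RatDual R H D) := inferInstanceAs (Algebra R ↥(ratDual R H D))

variable {R H D} in
/-- The element of `D^0` given by a rational functional. -/
def RatDual.mk (f : D →ₗ[R] R) (hf : toConv f ∈ ratDual R H D) : RatDual R H D := ⟨toConv f, hf⟩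

variable {R H D} in
/-- The underlying functional of `f ∈ D^0`. -/
def RatDual.eval : RatDual R H D →ₗ[R] (D →ₗ[R] R) :=
  (WithConv.linearEquiv R (D →ₗ[R] R)).toLinearMap ∘ₗ (ratDual R H D).val.toLinearMap

variable {R H D} in
lemma RatDual.ext {f g : RatDual R H D} (h : ∀ d, RatDual.eval f d = RatDual.eval g d) : f = g :=
  Subtype.ext (WithConv.ext (LinearMap.ext h))

variable {R H D} in
@[simp] lemma RatDual.eval_mk (f : D →ₗ[R] R) (hf : toConv f ∈ ratDual R H D) :
    RatDual.eval (RatDual.mk f hf) = f := rfl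

/-- The inclusion `D^0 → D^*`. -/
def ratDualVal : RatDual R H D →ₐ[R] WithConv (D →ₗ[R] R) := (ratDual R H D).val


variable {R H D}

lemma alphaMap_lTensor_regAct {M : Type x} [AddCommMonoid M] [Module R M]
    (t : M ⊗[R] FinDual R H) (h k : H) :
    alphaMap R H M (((regAct R H).flip h).lTensor M t) k = alphaMap R H M t (k * h) := by
  induction t with
  | zero => simp
  | add s t hs ht => simp only [map_add, LinearMap.add_apply, hs, ht]
  | tmul m f => simp

lemma dualAct_mem_ratDual {f : WithConv (D →ₗ[R] R)} (hf : f ∈ ratDual R H D) (h : H) :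
    dualAct R H D h f ∈ ratDual R H D := by
  obtain ⟨t, ht⟩ := hf
  refine ⟨((regAct R H).flip h).lTensor _ t, LinearMap.ext fun k => ?_⟩
  rw [alphaMap_lTensor_regAct, ht]
  simp

variable (R H D)

/-- The left `H`-action on `D^0`, restricted from `D^*`. -/
def ratDualAct : RatDual R H D →ₗ[R] (H →ₗ[R] RatDual R H D) :=
  LinearMap.mk₂ R (fun f h => RatDual.mk (dualAct R H D h f.1).ofConv (dualAct_mem_ratDual f.2 h))
    (fun _ _ _ => RatDual.ext fun _ => rfl)
    (fun _ _ _ => RatDual.ext fun _ => rfl)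
    (fun f h k => RatDual.ext fun d => by
      change f.1.ofConv (op (h + k) • d) = f.1.ofConv (op h • d) + f.1.ofConv (op k • d)
      rw [op_add, add_smul, map_add])
    (fun r f h => RatDual.ext fun d => by
      change f.1.ofConv (op (r • h) • d) = r • f.1.ofConv (op h • d)
      rw [op_smul, smul_assoc, map_smul])

lemma ratDualAct_mem_range [IsAlphaAlgebra R H] (f : RatDual R H D) :
    ratDualAct R H D f ∈ LinearMap.range (alphaMap R H (RatDual R H D)) := by
  obtain ⟨t, ht⟩ := f.2
  obtain ⟨t', ht'⟩ := exists_rTensor_eq (ratDualVal R H D).toLinearMap t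
    fun h => ⟨ratDualAct R H D f h, (LinearMap.congr_fun ht h).symm⟩
  refine ⟨t', LinearMap.ext fun h => Subtype.ext ?_⟩
  have h1 := alphaMap_rTensor (ratDualVal R H D).toLinearMap t' h
  rw [ht', ht] at h1
  exact h1.symm

lemma ratDualAct_mul (f g : RatDual R H D) : toConv (ratDualAct R H D (f * g)) =
    toConv (ratDualAct R H D f) * toConv (ratDualAct R H D g) := by
  apply WithConv.ext
  ext h : 1
  apply Subtype.ext
  have h1 := congrArg (fun F => F.ofConv h) (dualAct_mul R H D f.1 g.1)
  refine h1.trans ?_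
  simp only [LinearMap.convMul_apply]
  change _ = ratDualVal R H D _
  generalize (comul h : H ⊗[R] H) = y
  induction y with
  | zero => simp only [map_zero]
  | add z₁ z₂ h₁ h₂ => simp only [map_add, h₁, h₂]
  | tmul h₁ h₂ => rfl

lemma ratDualAct_one : toConv (ratDualAct R H D 1) = 1 := by
  apply WithConv.ext
  ext h : 1
  apply Subtype.ext
  exact congrArg (fun F => F.ofConv h) (dualAct_one R H D)

lemma ratDualAct_assoc (f : RatDual R H D) (b c : H) :
    ratDualAct R H D f (c * b) = ratDualAct R H D (ratDualAct R H D f b) c :=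
  Subtype.ext (LinearMap.congr_fun (map_mul (dualAct R H D) c b) f.1)

lemma ratDualAct_apply_one (f : RatDual R H D) : ratDualAct R H D f 1 = f :=
  Subtype.ext (LinearMap.congr_fun (map_one (dualAct R H D)) f.1)

/-- The coaction `ϱ : D^0 → D^0 ⊗ H°`: `ϱ f` is the unique element `∑ f₀ ⊗ f₁` of `D^0 ⊗ H°` with
`h f = ∑ f₁(h) f₀` for all `h`. -/
def ratDualCoact [IsAlphaAlgebra R H] : RatDual R H D →ₗ[R] RatDual R H D ⊗[R] FinDual R H :=
  coactionOfRange (ratDualAct R H D) (ratDualAct_mem_range R H D)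

lemma ratDualCoact_coassoc [IsAlphaAlgebra R H] (f : RatDual R H D) :
    TensorProduct.assoc R (RatDual R H D) (FinDual R H) (FinDual R H)
      ((ratDualCoact R H D).rTensor (FinDual R H) (ratDualCoact R H D f)) =
      (comul : FinDual R H →ₗ[R] FinDual R H ⊗[R] FinDual R H).lTensor (RatDual R H D)
        (ratDualCoact R H D f) :=
  coactionOfRange_coassoc (ratDualAct R H D) (ratDualAct_mem_range R H D)
    (ratDualAct_assoc R H D) f

lemma ratDualCoact_counit [IsAlphaAlgebra R H] (f : RatDual R H D) :
    TensorProduct.rid R (RatDual R H D) ((counit : FinDual R H →ₗ[R] R).lTensor (RatDual R H D)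
      (ratDualCoact R H D f)) = f := by
  change TensorProduct.rid R (RatDual R H D) (finDualCounit.lTensor (RatDual R H D)
    (coactionOfRange (ratDualAct R H D) (ratDualAct_mem_range R H D) f)) = f
  rw [lTensor_counit_eq, alphaMap_coactionOfRange, TensorProduct.rid_tmul, one_smul,
    ratDualAct_apply_one]

lemma ratDualCoact_one [IsAlphaAlgebra R H] : ratDualCoact R H D 1 = 1 :=
  coactionOfRange_one _ _ (ratDualAct_one R H D)

lemma ratDualCoact_mul [IsAlphaAlgebra R H] (f g : RatDual R H D) :
    ratDualCoact R H D (f * g) = ratDualCoact R H D f * ratDualCoact R H D g :=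
  coactionOfRange_mul _ _ (ratDualAct_mul R H D) f g

/-- `D^0` is a right `H°`-comodule algebra. -/
instance [IsAlphaAlgebra R H] : RightComoduleAlgebra R (FinDual R H) (RatDual R H D) where
  coact := ratDualCoact R H D
  coassoc := ratDualCoact_coassoc R H D
  counit := ratDualCoact_counit R H D
  coact_one := ratDualCoact_one R H D
  coact_mul := ratDualCoact_mul R H D

variable {R H D}

lemma alphaMap_ratDualCoact [IsAlphaAlgebra R H] (f : RatDual R H D) :
    alphaMap R H (RatDual R H D) (ratDualCoact R H D f) = ratDualAct R H D f :=
  alphaMap_coactionOfRange _ _ f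

variable {E : Type x} [AddCommGroup E] [Module R E] [Module Hᵐᵒᵖ E] [IsScalarTower R Hᵐᵒᵖ E]
  [Coalgebra R E] [IsRightModuleCoalgebra R H E]

lemma comp_mem_ratDual (p : D →ₗc[R] E) (hp : ∀ (h : Hᵐᵒᵖ) (d : D), p (h • d) = h • p d)
    {f : WithConv (E →ₗ[R] R)} (hf : f ∈ ratDual R H E) :
    toConv (f.ofConv ∘ₗ p.toLinearMap) ∈ ratDual R H D := by
  obtain ⟨t, ht⟩ := hf
  let q : WithConv (E →ₗ[R] R) →ₗ[R] WithConv (D →ₗ[R] R) :=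
    { toFun := fun f => toConv (f.ofConv ∘ₗ p.toLinearMap)
      map_add' := fun _ _ => rfl
      map_smul' := fun _ _ => rfl }
  refine ⟨q.rTensor _ t, LinearMap.ext fun h => ?_⟩
  rw [alphaMap_rTensor, ht]
  apply WithConv.ext
  ext d
  exact congrArg f.ofConv (hp (op h) d).symm

/-- The algebra map `p° : E^0 → D^0`, `f ↦ f ∘ p`, induced by an `H`-linear coalgebra map
`p : D → E`. -/
def ratDualMap (p : D →ₗc[R] E) (hp : ∀ (h : Hᵐᵒᵖ) (d : D), p (h • d) = h • p d) :
    RatDual R H E →ₐ[R] RatDual R H D :=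
  AlgHom.ofLinearMap
    { toFun := fun f => RatDual.mk (RatDual.eval f ∘ₗ p.toLinearMap) (comp_mem_ratDual p hp f.2)
      map_add' := fun _ _ => rfl
      map_smul' := fun _ _ => rfl }
    (Subtype.ext (WithConv.ext (LinearMap.ext fun d => CoalgHomClass.counit_comp_apply p d)))
    (fun f g => Subtype.ext (WithConv.ext
      (LinearMap.convMul_comp_coalgHom_distrib f.1 g.1 p)))

variable (R H D)

/-- The map `π° : C^0 → D^0`, `g ↦ g ∘ π`, dual to the coextension `π : D → C = D / D H⁺`. -/
def dualCoextension : RatDual R H (CoinvQuot R H D) →ₐ[R] RatDual R H D :=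
  ratDualMap (coextension R H D) (coextension_smul R H D)

end RationalDual

end HopfDuality

end

open HopfDuality

namespace HopfDuality

/-! ### Coinvariants of `D^0` and the image of `π°`. -/

section Coextension

variable {R : Type u} [CommRing R] [IsNoetherianRing R] {H : Type v} [Ring H] [Bialgebra R H]
  {D : Type w} [AddCommGroup D] [Module R D] [Module Hᵐᵒᵖ D] [IsScalarTower R Hᵐᵒᵖ D]
  [Coalgebra R D] [IsRightModuleCoalgebra R H D]

/-! Purity of `H°` makes `α_N : N ⊗ H° → Hom_R(H, N)` injective, so every identity between elements
of `D^0 ⊗ H°` can be checked on the action of `H`. The whole argument is then transposition of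
statements about `D` and `H`.

Extension: under `α`, the condition `ϱ f = f ⊗ 1` becomes `f(dh) = ε(h) f(d)`, which says that `f`
kills `D H⁺` and so factors through `π` (`mem_coinvariants_ratDual`, `exists_dualCoextension_eq`).
Injectivity of `π°` is surjectivity of `π`.

Cleftness: `Δ` on `H°` is the transpose of multiplication in `H`, and multiplication in `D^0` is the
transpose of `Δ` on `D`. Hence, if `γ`, `γ'` are precomposition with `φ`, `φ'`, then `γ * γ'` is
precomposition with `φ * φ'`, in the same order (`eval_convMul`). Inverse maps in `Hom(D, H)` thus
give inverse maps in `Hom(H°, D^0)`, as soon as the functionals `f ∘ ω` and `f ∘ ω⁻¹` are known to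
be rational.

Rationality of `f ∘ ω` and colinearity of `f ↦ f ∘ ω` both express `ω(dh) = ω(d)h`. For the inverse,
uniqueness of convolution inverses in `Hom(D ⊗ H, H)` gives `ω⁻¹(dh) = S(h) ω⁻¹(d)`
(`IsCointegral.inv_op_smul`). Therefore `h(f ∘ ω⁻¹) = ∑ f₁(S h) (f₂ ∘ ω⁻¹)`, which is rational
because `f₁ ∘ S` stays in `H°` (`comp_antipode_mem_finiteDual`). -/

lemma eval_ratDualAct (f : RatDual R H D) (h : H) (d : D) :
    RatDual.eval (ratDualAct R H D f h) d = RatDual.eval f (op h • d) := rfl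

lemma eval_dualCoextension (g : RatDual R H (CoinvQuot R H D)) (d : D) :
    RatDual.eval (dualCoextension R H D g) d = RatDual.eval g (coextension R H D d) := rfl

/-- An element of `D^0` is coinvariant iff it is an `H`-invariant functional. -/
lemma mem_coinvariants_ratDual [IsAlphaAlgebra R H] {f : RatDual R H D} :
    f ∈ coinvariants R (FinDual R H) (RatDual R H D) ↔
      ∀ (h : H) (d : D), RatDual.eval f (op h • d) = counit (R := R) h * RatDual.eval f d := by
  -- After `α` the two tensors become the maps `h ↦ h f` and `h ↦ ε(h) f`, the unit of `H°` being
  -- `ε`.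
  rw [mem_coinvariants, ← (alphaMap_injective (R := R) (H := H) (RatDual R H D)).eq_iff]
  change alphaMap R H _ (ratDualCoact R H D f) = _ ↔ _
  rw [alphaMap_ratDualCoact]
  constructor
  · intro hf h d
    rw [← eval_ratDualAct, hf, alphaMap_tmul, eval_one, map_smul, LinearMap.smul_apply,
      smul_eq_mul]
  · intro hf
    ext h : 1
    refine RatDual.ext fun d => ?_
    rw [eval_ratDualAct, hf, alphaMap_tmul, eval_one, map_smul, LinearMap.smul_apply,
      smul_eq_mul]

/-- Invariance forces `f` to vanish on the generators `dh` of `D H⁺`, where `ε(h) = 0`, so `f`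
descends to `D / D H⁺`. What remains is rationality of the descended functional over the quotient.
-/
lemma exists_dualCoextension_eq {f : RatDual R H D}
    (hf : ∀ (h : H) (d : D), RatDual.eval f (op h • d) = counit (R := R) h * RatDual.eval f d) :
    ∃ g, dualCoextension R H D g = f := by
  have hle : augSubmodule R H D ≤ LinearMap.ker (RatDual.eval f) := by
    refine Submodule.span_le.2 ?_
    rintro _ ⟨d, h, hh, rfl⟩
    rw [SetLike.mem_coe, LinearMap.mem_ker, hf, hh, zero_mul]
  let g : CoinvQuot R H D →ₗ[R] R := (augSubmodule R H D).liftQ (RatDual.eval f) hle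
  have hg : ∀ d, g (coextension R H D d) = RatDual.eval f d := fun d => rfl
  have hmem : toConv g ∈ ratDual R H (CoinvQuot R H D) := by
    -- The action of `H` on the quotient goes through `ε`, so `h g = ε(h) g`; since `ε` is the unit
    -- of `H°`, the tensor `g ⊗ 1` witnesses rationality.
    refine ⟨toConv g ⊗ₜ 1, LinearMap.ext fun h => WithConv.ext (LinearMap.ext fun c => ?_)⟩
    obtain ⟨d, rfl⟩ := coextension_surjective R H D c
    rw [alphaMap_tmul, eval_one]
    change counit (R := R) h • g (coextension R H D d) =
      g (coextension R H D (op h • d))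
    rw [hg, hg, hf, smul_eq_mul]
  exact ⟨RatDual.mk g hmem, RatDual.ext fun d => rfl⟩

variable (R H D) in
lemma isRightExtension_dualCoextension [IsAlphaAlgebra R H] :
    IsRightExtension (FinDual R H) (dualCoextension R H D) where
  injective g₁ g₂ hg := RatDual.ext fun c => by
    obtain ⟨d, rfl⟩ := coextension_surjective R H D c
    rw [← eval_dualCoextension, hg, eval_dualCoextension]
  range_eq := by
    ext f
    rw [mem_coinvariants_ratDual]
    refine ⟨?_, exists_dualCoextension_eq⟩
    rintro ⟨g, rfl⟩ h d
    -- Functionals of the form `g ∘ π` are invariant because `π(dh) = ε(h) π(d)`.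
    exact (congrArg (RatDual.eval g) (mkQ_op_smul R H D d h)).trans (map_smul _ _ _)

end Coextension

/-! ### Transposing convolution products. -/

section Pairing

variable {R : Type u} [CommRing R] [IsNoetherianRing R] {H : Type v} [Ring H] [Bialgebra R H]
  {D : Type w} [AddCommGroup D] [Module R D]

variable (H) in
/-- Precomposition `H° → D^*`, `f ↦ f ∘ φ`, with a linear map `φ : D → H`. -/
noncomputable def precomp (φ : D →ₗ[R] H) : FinDual R H →ₗ[R] WithConv (D →ₗ[R] R) where
  toFun f := toConv (FinDual.eval f ∘ₗ φ)
  map_add' _ _ := rfl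
  map_smul' _ _ := rfl

/-- The pairing of `H° ⊗ H°` with `H ⊗ H`, `⟨a ⊗ b, f ⊗ g⟩ = f(a) g(b)`. -/
noncomputable def pairing (s : FinDual R H ⊗[R] FinDual R H) : H ⊗[R] H →ₗ[R] R :=
  TensorProduct.lift (FinDual.eval ∘ₗ alphaMap R H (FinDual R H) s).flip

lemma pairing_tmul (s : FinDual R H ⊗[R] FinDual R H) (a b : H) :
    pairing s (a ⊗ₜ b) = FinDual.eval (alphaMap R H (FinDual R H) s b) a := rfl

lemma pairing_zero : pairing (0 : FinDual R H ⊗[R] FinDual R H) = 0 :=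
  TensorProduct.ext' fun a b => by simp [pairing_tmul]

lemma pairing_add (s t : FinDual R H ⊗[R] FinDual R H) :
    pairing (s + t) = pairing s + pairing t :=
  TensorProduct.ext' fun a b => by simp [pairing_tmul]

/-- This is the defining property `∑ f₁(a) f₂(b) = f(ab)` of the comultiplication, in the form in
which a product in `H` can be moved across to `H°`. -/
lemma pairing_comul [IsAlphaAlgebra R H] (f : FinDual R H) :
    pairing (comul (R := R) f) = FinDual.eval f ∘ₗ LinearMap.mul' R H :=
  TensorProduct.ext' fun a b => by
    rw [pairing_tmul, finDual_comul_def, alphaMap_finDualComul]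
    rfl

variable [Module Hᵐᵒᵖ D] [IsScalarTower R Hᵐᵒᵖ D] [Coalgebra R D] [IsRightModuleCoalgebra R H D]

/-- An arbitrary tensor `s` stands in place of `Δ f`, so that induction on `s` applies. On `f ⊗ g`
both sides are `∑ f(φ d₁) g(φ' d₂)`, since `D^0` multiplies by convolution. Only the values of `γ`
and `γ'` matter; no `H`-linearity of `φ` or `φ'` enters. -/
lemma eval_mul'_map {γ γ' : FinDual R H →ₗ[R] RatDual R H D} {φ φ' : D →ₗ[R] H}
    (hγ : ∀ f, (γ f).eval = FinDual.eval f ∘ₗ φ) (hγ' : ∀ f, (γ' f).eval = FinDual.eval f ∘ₗ φ')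
    (s : FinDual R H ⊗[R] FinDual R H) (d : D) :
    RatDual.eval (LinearMap.mul' R _ (TensorProduct.map γ γ' s)) d =
      pairing s (TensorProduct.map φ φ' (comul d)) := by
  induction s with
  | zero => simp [pairing_zero]
  | add s t hs ht => simp only [map_add, LinearMap.add_apply, pairing_add, hs, ht]
  | tmul f g =>
    change LinearMap.mul' R R (TensorProduct.map (γ f).eval (γ' g).eval (comul d)) = _
    rw [hγ, hγ']
    generalize (comul d : D ⊗[R] D) = z
    induction z with
    | zero => simp
    | add z₁ z₂ h₁ h₂ => simp only [map_add, h₁, h₂]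
    | tmul a b => simp [pairing_tmul, mul_comm]

variable [IsAlphaAlgebra R H]

/-- Dualization turns convolution products in `Hom(D, H)` into convolution products in
`Hom(H°, D^0)`. -/
lemma eval_convMul {γ γ' : FinDual R H →ₗ[R] RatDual R H D} {φ φ' : D →ₗ[R] H}
    (hγ : ∀ f, (γ f).eval = FinDual.eval f ∘ₗ φ) (hγ' : ∀ f, (γ' f).eval = FinDual.eval f ∘ₗ φ')
    (f : FinDual R H) :
    RatDual.eval ((toConv γ * toConv γ').ofConv f) =
      FinDual.eval f ∘ₗ (toConv φ * toConv φ').ofConv := by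
  ext d
  change RatDual.eval (LinearMap.mul' R _ (TensorProduct.map γ γ' (comul f))) d = _
  rw [eval_mul'_map hγ hγ', pairing_comul]
  rfl

/-- The unit of `Hom(D, H)` is `d ↦ ε(d) 1`, and composing it with `f` gives `f(1) ε`. As `f ↦ f(1)`
is the counit of `H°` and `ε` is the unit of `D^0`, this is the unit of `Hom(H°, D^0)` at `f`. -/
lemma convMul_eq_one {γ γ' : FinDual R H →ₗ[R] RatDual R H D} {φ φ' : D →ₗ[R] H}
    (hγ : ∀ f, (γ f).eval = FinDual.eval f ∘ₗ φ) (hγ' : ∀ f, (γ' f).eval = FinDual.eval f ∘ₗ φ')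
    (h : toConv φ * toConv φ' = 1) : toConv γ * toConv γ' = 1 := by
  apply WithConv.ext
  ext f : 1
  refine RatDual.ext fun d => ?_
  rw [eval_convMul hγ hγ', h]
  simp only [LinearMap.convOne_def, LinearMap.comp_apply, Algebra.linearMap_apply,
    Algebra.algebraMap_eq_smul_one, map_smul, finDual_counit_def, LinearMap.smul_apply,
    smul_eq_mul]
  rw [mul_comm]
  rfl

end Pairing

/-! ### The inverse of a cointegral is twisted by the antipode. -/

section ModuleCoalgebra

variable {R : Type u} [CommRing R] {H : Type v} [Ring H] [HopfAlgebra R H]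
  {D : Type w} [AddCommGroup D] [Module R D] [Module Hᵐᵒᵖ D] [IsScalarTower R Hᵐᵒᵖ D]
  [Coalgebra R D] [IsRightModuleCoalgebra R H D]

variable (R H D) in
/-- The action `D ⊗ H → D` of a module coalgebra, as a coalgebra map. -/
noncomputable def rightActionCoalgHom : D ⊗[R] H →ₗc[R] D where
  __ := TensorProduct.lift (rightAction R H D)
  counit_comp := TensorProduct.ext' fun d h => by
    simp [IsRightModuleCoalgebra.counit_smul, mul_comm]
  map_comp_comul := TensorProduct.ext' fun d h => by
    simp only [LinearMap.comp_apply, TensorProduct.lift.tmul, rightAction_apply,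
      IsRightModuleCoalgebra.comul_smul, TensorProduct.comul_tmul]
    generalize (comul d : D ⊗[R] D) = z
    generalize (comul h : H ⊗[R] H) = y
    induction z with
    | zero => simp
    | add z₁ z₂ h₁ h₂ => simp only [map_add, LinearMap.add_apply, TensorProduct.add_tmul, h₁, h₂]
    | tmul d₁ d₂ =>
      induction y with
      | zero => simp
      | add z₁ z₂ h₁ h₂ => simp only [map_add, TensorProduct.tmul_add, h₁, h₂]
      | tmul h₁ h₂ => simp

open HopfAlgebra

/-- The convolution inverse of a cointegral `ω` satisfies `ω⁻¹(d h) = S(h) ω⁻¹(d)`. -/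
lemma IsCointegral.inv_op_smul
    {ω ω' : D →ₗ[R] H} (hω : IsCointegral ω)
    (h₁ : toConv ω * toConv ω' = 1) (h₂ : toConv ω' * toConv ω = 1) (d : D) (h : H) :
    ω' (op h • d) = antipode R h * ω' d := by
  -- In the convolution algebra `Hom(D ⊗ H, H)`, the map `ω ∘ p : d ⊗ h ↦ ω(d)h` has left inverse
  -- `ω' ∘ p` and right inverse `Z : d ⊗ h ↦ S(h) ω'(d)`. The two must coincide, which is the claim.
  let p := rightActionCoalgHom R H D
  let Z : D ⊗[R] H →ₗ[R] H :=
    LinearMap.mul' R H ∘ₗ TensorProduct.map (antipode R) ω' ∘ₗ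
      (TensorProduct.comm R D H).toLinearMap
  -- Precomposition with a coalgebra map preserves convolution products and units.
  have hY : toConv (ω' ∘ₗ p.toLinearMap) * toConv (ω ∘ₗ p.toLinearMap) = 1 := by
    have := LinearMap.convMul_comp_coalgHom_distrib (toConv ω') (toConv ω) p
    apply WithConv.ext
    refine this.symm.trans ?_
    rw [h₂]
    ext x
    simp [LinearMap.convOne_def]
  have hZ : toConv (ω ∘ₗ p.toLinearMap) * toConv Z = 1 := by
    apply WithConv.ext
    refine TensorProduct.ext' fun d h => ?_
    have hd : LinearMap.mul' R H (TensorProduct.map ω ω' (comul d)) =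
        algebraMap R H (counit (R := R) d) := congrArg (fun F => F.ofConv d) h₁
    -- Here `z` and `y` replace `Δ d` and `Δ h`, which allows induction on both. The terms `ω(d₁) h₁
    -- S(h₂) ω'(d₂)` are regrouped so that the `H`-part `h₁ S(h₂)` is collected between `ω` and
    -- `ω'`.
    have key : ∀ (z : D ⊗[R] D) (y : H ⊗[R] H),
        LinearMap.mul' R H (TensorProduct.map (ω ∘ₗ p.toLinearMap) Z
          (TensorProduct.AlgebraTensorModule.tensorTensorTensorComm R R R R D D H H (z ⊗ₜ y))) =
        LinearMap.mul' R H (TensorProduct.map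
          (LinearMap.mulRight R (LinearMap.mul' R H ((antipode R).lTensor H y)) ∘ₗ ω) ω' z) := by
      intro z y
      induction z with
      | zero => simp
      | add z₁ z₂ h₁ h₂ => simp only [map_add, TensorProduct.add_tmul, h₁, h₂]
      | tmul d₁ d₂ =>
        induction y with
        | zero => simp
        | add y₁ y₂ h₁ h₂ =>
          simp only [map_add, TensorProduct.tmul_add, h₁, h₂, TensorProduct.map_tmul,
            LinearMap.comp_apply, LinearMap.mulRight_apply, LinearMap.mul'_apply, mul_add, add_mul]
        | tmul b₁ b₂ =>
          have hp : ω (p (d₁ ⊗ₜ[R] b₁)) = ω d₁ * b₁ := hω d₁ b₁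
          simp [Z, hp, mul_assoc]
    refine (key (comul d) (comul h)).trans ?_
    rw [mul_antipode_lTensor_comul_apply]
    -- The collected factor has become the central scalar `ε(h)`; pulling it out leaves `∑ ω(d₁)
    -- ω'(d₂) = ε(d)`.
    have hc : LinearMap.mulRight R (algebraMap R H (counit (R := R) h)) ∘ₗ ω =
        counit (R := R) h • ω := by
      ext a
      simp [Algebra.smul_def, Algebra.commutes]
    rw [hc, TensorProduct.map_smul_left, LinearMap.smul_apply, map_smul, hd]
    simp [LinearMap.convOne_def, Algebra.smul_def]
  have := left_inv_eq_right_inv hY hZ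
  exact congrArg (fun F => F.ofConv (d ⊗ₜ h)) this

end ModuleCoalgebra

/-! ### Rationality of the dualized maps and construction of the integral. -/

section Cointegral

variable {R : Type u} [CommRing R] [IsNoetherianRing R] {H : Type v} [Ring H]
  {D : Type w} [AddCommGroup D] [Module R D] [Module Hᵐᵒᵖ D] [Coalgebra R D]

section Bialgebra

variable [Bialgebra R H] [IsAlphaAlgebra R H] [IsScalarTower R Hᵐᵒᵖ D]
  [IsRightModuleCoalgebra R H D]

lemma IsCointegral.precomp_mem_ratDual {ω : D →ₗ[R] H} (hω : IsCointegral ω) (f : FinDual R H) :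
    precomp H ω f ∈ ratDual R H D := by
  -- The witness `∑ (f₁ ∘ ω) ⊗ f₂` comes from `f(ω(dh)) = f(ω(d)h) = ∑ f₁(ω d) f₂(h)`.
  refine ⟨(precomp H ω).rTensor _ (finDualComul f), LinearMap.ext fun h =>
    WithConv.ext (LinearMap.ext fun d => ?_)⟩
  rw [alphaMap_rTensor, alphaMap_finDualComul]
  exact congrArg (FinDual.eval f) (hω d h).symm

/-- A linear map `γ : H° → D^0` of the form `f ↦ f ∘ ω`, with `ω` a cointegral, is an integral. -/
lemma IsCointegral.isComoduleIntegral {ω : D →ₗ[R] H} (hω : IsCointegral ω)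
    {γ : FinDual R H →ₗ[R] RatDual R H D} (hγ : ∀ f, (γ f).eval = FinDual.eval f ∘ₗ ω) :
    IsComoduleIntegral γ := by
  intro f
  -- Compared through `α` at `h` and then evaluated at `d`, the two sides are `f(ω(dh))` and
  -- `f(ω(d)h)`.
  apply alphaMap_injective
  ext h : 1
  refine RatDual.ext fun d => ?_
  change RatDual.eval (alphaMap R H _ (ratDualCoact R H D (γ f)) h) d = _
  rw [alphaMap_ratDualCoact, eval_ratDualAct, alphaMap_rTensor, finDual_comul_def,
    alphaMap_finDualComul, hγ, hγ]
  exact congrArg (FinDual.eval f) (hω d h)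

end Bialgebra

variable [HopfAlgebra R H]

open HopfAlgebra

/-- Since `S(xay) = S(y) S(a) S(x)`, the bimodule generated by `f ∘ S` lies in the image of `HfH`
under precomposition with `S`. That image is finitely generated, and `R` is noetherian. -/
lemma comp_antipode_mem_finiteDual {f : H →ₗ[R] R} (hf : f ∈ finiteDual R H) :
    f ∘ₗ antipode R ∈ finiteDual R H := by
  refine fg_of_le (Q := (bimoduleSpan R f).map (LinearMap.lcomp R R (antipode R))) ?_
    (Submodule.FG.map _ hf)
  refine Submodule.span_le.2 ?_
  rintro _ ⟨x, y, rfl⟩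
  refine ⟨_, Submodule.subset_span ⟨antipode R y, antipode R x, rfl⟩, ?_⟩
  ext a
  simp [antipode_mul_antidistrib, mul_assoc]

variable (R H) in
/-- The antipode `f ↦ f ∘ S` of `H°`. -/
noncomputable def finDualAntipode : FinDual R H →ₗ[R] FinDual R H where
  toFun f := FinDual.mk (FinDual.eval f ∘ₗ antipode R) (comp_antipode_mem_finiteDual f.eval_mem)
  map_add' _ _ := rfl
  map_smul' _ _ := rfl

/-- Used with `s = Δ f`: the tensor `∑ f₂ ⊗ (f₁ ∘ S)` then acts by `h ↦ [a ↦ f(S(h)a)]`. The swap is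
needed because `S(h)` stands on the left, while `α` evaluates the second tensor factor at `h`. -/
lemma eval_alphaMap_comm_antipode (s : FinDual R H ⊗[R] FinDual R H) (h a : H) :
    FinDual.eval (alphaMap R H (FinDual R H) (TensorProduct.comm R _ _
      ((finDualAntipode R H).rTensor _ s)) h) a = pairing s (antipode R h ⊗ₜ a) := by
  induction s with
  | zero => simp [pairing_zero]
  | add s t hs ht => simp only [map_add, LinearMap.add_apply, pairing_add, hs, ht]
  | tmul f g =>
    simp only [LinearMap.rTensor_tmul, TensorProduct.comm_tmul, pairing_tmul, alphaMap_tmul,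
      map_smul, LinearMap.smul_apply, smul_eq_mul]
    exact mul_comm _ _

variable [IsScalarTower R Hᵐᵒᵖ D] [IsRightModuleCoalgebra R H D]

lemma IsCointegral.precomp_inv_mem_ratDual [IsAlphaAlgebra R H] {ω ω' : D →ₗ[R] H}
    (hω : IsCointegral ω)
    (h₁ : toConv ω * toConv ω' = 1) (h₂ : toConv ω' * toConv ω = 1) (f : FinDual R H) :
    precomp H ω' f ∈ ratDual R H D := by
  -- The witness `∑ (f₂ ∘ ω') ⊗ (f₁ ∘ S)` is read off from `f(ω'(dh)) = f(S(h) ω'(d))`.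
  refine ⟨(precomp H ω').rTensor _ (TensorProduct.comm R _ _
      ((finDualAntipode R H).rTensor _ (comul f))), LinearMap.ext fun h =>
    WithConv.ext (LinearMap.ext fun d => ?_)⟩
  rw [alphaMap_rTensor]
  refine (eval_alphaMap_comm_antipode (comul f) h (ω' d)).trans ?_
  rw [pairing_comul]
  exact congrArg (FinDual.eval f) (hω.inv_op_smul h₁ h₂ d h).symm

lemma IsCointegral.exists_integral [IsAlphaAlgebra R H] {ω ω' : D →ₗ[R] H}
    (hω : IsCointegral ω)
    (h₁ : toConv ω * toConv ω' = 1) (h₂ : toConv ω' * toConv ω = 1) :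
    ∃ γ γ' : FinDual R H →ₗ[R] RatDual R H D,
      (∀ f, (γ f).eval = f.eval ∘ₗ ω) ∧ (∀ f, (γ' f).eval = f.eval ∘ₗ ω') ∧
      IsComoduleIntegral γ ∧ toConv γ * toConv γ' = 1 ∧ toConv γ' * toConv γ = 1 := by
  -- The type `RatDual R H D` unfolds to the carrier of this submodule, so the corestricted
  -- precomposition maps have the required type and their evaluation formulas hold by `rfl`.
  let γ : FinDual R H →ₗ[R] RatDual R H D :=
    (precomp H ω).codRestrict (Subalgebra.toSubmodule (ratDual R H D)) hω.precomp_mem_ratDual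
  let γ' : FinDual R H →ₗ[R] RatDual R H D :=
    (precomp H ω').codRestrict (Subalgebra.toSubmodule (ratDual R H D))
      (hω.precomp_inv_mem_ratDual h₁ h₂)
  have hγ : ∀ f, (γ f).eval = f.eval ∘ₗ ω := fun _ => rfl
  have hγ' : ∀ f, (γ' f).eval = f.eval ∘ₗ ω' := fun _ => rfl
  exact ⟨γ, γ', hγ, hγ', hω.isComoduleIntegral hγ, convMul_eq_one hγ hγ' h₁,
    convMul_eq_one hγ' hγ h₂⟩

end Cointegral

end HopfDuality

theorem mainTheorem5 {R : Type u} {H : Type v} {D : Type w}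
    [CommRing R] [IsNoetherianRing R] [Ring H] [HopfAlgebra R H] [IsAlphaAlgebra R H]
    (hS : Function.Bijective (HopfAlgebra.antipode R : H →ₗ[R] H))
    [AddCommGroup D] [Module R D] [Coalgebra R D]
    [Module Hᵐᵒᵖ D] [IsScalarTower R Hᵐᵒᵖ D] [IsRightModuleCoalgebra R H D] :
    IsRightExtension (FinDual R H) (dualCoextension R H D) ∧
    (IsCocleft R H D → IsCleftExtension (FinDual R H) (dualCoextension R H D)) ∧
    ∀ ω ω' : D →ₗ[R] H, IsCointegral ω →
      toConv ω * toConv ω' = 1 → toConv ω' * toConv ω = 1 →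
      ∃ γ γ' : FinDual R H →ₗ[R] RatDual R H D,
        (∀ f, (γ f).eval = f.eval ∘ₗ ω) ∧ (∀ f, (γ' f).eval = f.eval ∘ₗ ω') ∧
        IsComoduleIntegral γ ∧
        toConv γ * toConv γ' = 1 ∧ toConv γ' * toConv γ = 1 := by
  refine ⟨isRightExtension_dualCoextension R H D, ?_, fun ω ω' hω h₁ h₂ =>
    hω.exists_integral h₁ h₂⟩
  rintro ⟨ω, hω, hu⟩
  -- Unpacking the unit yields the inverse `ω'` as an element of the convolution algebra, hence the
  -- later `ω'.ofConv`.
  obtain ⟨⟨_, ω', h₁, h₂⟩, rfl⟩ := hu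
  obtain ⟨γ, γ', -, -, hγ, h₃, h₄⟩ := hω.exists_integral (ω' := ω'.ofConv) h₁ h₂
  exact ⟨isRightExtension_dualCoextension R H D, γ, hγ, ⟨toConv γ, toConv γ', h₃, h₄⟩, rfl⟩
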